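/- Let $P$ be a monic polynomial with complex coefficients of degree $q\ge 1$, let $r>0$, and let $\mu$ be area measure (two-dimensional Lebesgue measure) on the filled lemniscate $\{z\in\mathbb{C}:|P(z)|\le r\}$. Then $\mu$ has a sequence of orthonormal polynomials, that is, polynomials $\varphi_n$ ($n\ge 0$) with $\deg\varphi_n=n$, with positive leading coefficient $\kappa_n$, and with $\int \varphi_n\overline{\varphi_m}\,d\mu=\delta_{m,n}$ for all $m,n\ge 0$; and the leading coefficients of any such sequence satisfy $$\lim_{n\to\infty}\frac{\kappa_n}{\kappa_{n+q}}=r.$$ -/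

import Mathlib

open Filter Topology MeasureTheory

/-- Area (two-dimensional Lebesgue) measure on the filled lemniscate `{z : |P z| ≤ r}`. -/
noncomputable def lemniscateArea (P : Polynomial ℂ) (r : ℝ) : Measure ℂ :=
  (volume : Measure ℂ).restrict {z : ℂ | ‖P.eval z‖ ≤ r}

/-- `φ 0, φ 1, φ 2, …` are the orthonormal polynomials of the measure `μ`: `φ n` has degree
exactly `n` and positive (real) leading coefficient, and `∫ φ n * conj (φ m) dμ = δ_{m,n}`.
The diagonal relations force every `φ n` to be square integrable (the Bochner integral of a
non-integrable function is `0`), hence every integrand below is integrable. -/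
structure IsOrthonormalPolynomials (μ : Measure ℂ) (φ : ℕ → Polynomial ℂ) : Prop where
  natDegree_eq : ∀ n, (φ n).natDegree = n
  leadingCoeff_im : ∀ n, (φ n).leadingCoeff.im = 0
  leadingCoeff_pos : ∀ n, 0 < (φ n).leadingCoeff.re
  orthonormal : ∀ n m,
    ∫ z, (φ n).eval z * (starRingEnd ℂ) ((φ m).eval z) ∂μ = if m = n then 1 else 0

/-- The leading coefficient `κ_n` of the `n`-th orthonormal polynomial, as a real number. -/
noncomputable def leadingKappa (φ : ℕ → Polynomial ℂ) (n : ℕ) : ℝ :=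
  (φ n).leadingCoeff.re

/-!
The leading coefficients are governed by an extremal property: if `φ` is the orthonormal sequence
of `μ` and `p` has degree `n` and leading coefficient `c`, then `|c| / κ_n ≤ ‖p‖` in `L²(μ)`
(`norm_coeff_div_leadingCoeff_le`), because `c / κ_n` is the coefficient of `φ_n` in `p`.

*Upper bound.* `P * φ_n` has degree `n + q` and leading coefficient `κ_n`, and `|P| ≤ r` on the
lemniscate, so `κ_n / κ_{n+q} ≤ ‖P * φ_n‖ ≤ r` for every `n` (`leadingKappa_div_le`).

*Lower bound.* Divide `φ_{n+q} = P * s + t` with `deg t < q`. The quotient `s` has degree `n` and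
leading coefficient `κ_{n+q}`, so `κ_{n+q} / κ_n ≤ ‖s‖`, and it remains to see that
`limsup ‖s‖ ≤ 1 / ρ` for every `ρ < r`. Point evaluations in the interior are bounded functionals
for the area norm (the mean value property), so by Bessel's inequality `∑ |φ_n(z)|²` converges
there; consequently `φ_n → 0` uniformly on `{|P| ≤ ρ}` (`eventually_forall_norm_eval_le`). As all
zeros of `P` lie in `{|P| < ρ}`, splitting off one root at a time and using the maximum principle
shows that `s` is uniformly small on `{|P| ≤ ρ}` and `t` on the whole lemniscate
(`exists_division_bound`). Where `|P| ≥ ρ` one has `|s| ≤ (|φ_{n+q}| + |t|) / ρ`, so that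
`|s| ≤ |φ_{n+q}| / ρ + o(1)` uniformly on the lemniscate, which gives the claim because
`‖φ_{n+q}‖ = 1`.

Existence of the orthonormal sequence is Gram-Schmidt applied to the monomials in `L²`.
-/

open Polynomial

/-! ### The mean value property over discs and division by a linear factor -/

/-- The disc is invariant under a rotation `u` with `u ^ k = -1`, which changes the sign of the
integral. -/
lemma setIntegral_ball_pow (d : ℝ) {k : ℕ} (hk : k ≠ 0) :
    ∫ z in Metric.ball (0 : ℂ) d, z ^ k = 0 := by
  set u : Circle := Circle.exp (Real.pi / k) with hu
  have huk : (u : ℂ) ^ k = -1 := by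
    rw [hu, Circle.coe_exp, ← Complex.exp_nat_mul, ← Complex.exp_pi_mul_I]
    congr 1
    push_cast
    field_simp
  have hmp : MeasurePreserving (rotation u) (volume : Measure ℂ) volume :=
    (rotation u).measurePreserving
  have h := hmp.setIntegral_preimage_emb (rotation u).toHomeomorph.measurableEmbedding
    (fun z : ℂ => z ^ k) (Metric.ball 0 d)
  have hpre : (rotation u) ⁻¹' Metric.ball (0 : ℂ) d = Metric.ball 0 d := by
    ext z
    simp only [Set.mem_preimage, mem_ball_zero_iff, LinearIsometryEquiv.norm_map]
  rw [hpre] at h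
  simp only [rotation_apply, mul_pow, huk, neg_mul, one_mul, integral_neg] at h
  exact self_eq_neg.mp h.symm

lemma setIntegral_ball_polynomial (p : ℂ[X]) (a : ℂ) (d : ℝ) :
    ∫ z in Metric.ball a d, p.eval z = volume.real (Metric.ball a d) • p.eval a := by
  have hzero : ∀ p : ℂ[X], ∫ z in Metric.ball (0 : ℂ) d, p.eval z
      = volume.real (Metric.ball (0 : ℂ) d) • p.eval 0 := by
    intro p
    have hint : ∀ p : ℂ[X], IntegrableOn (fun z => p.eval z) (Metric.ball (0 : ℂ) d) := fun p =>
      (p.continuous.continuousOn.integrableOn_compact (isCompact_closedBall 0 d)).mono_set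
        Metric.ball_subset_closedBall
    induction p using Polynomial.induction_on' with
    | add p s hp hs =>
      simp only [eval_add, smul_add]
      rw [integral_add (hint p) (hint s), hp, hs]
    | monomial k c =>
      rcases eq_or_ne k 0 with rfl | hk
      · simp
      · simp [integral_const_mul, setIntegral_ball_pow d hk, hk]
  have hmp : MeasurePreserving (fun z : ℂ => z + a) volume volume :=
    measurePreserving_add_right volume a
  have h := hmp.setIntegral_preimage_emb (Homeomorph.addRight a).measurableEmbedding
    (fun z : ℂ => p.eval z) (Metric.ball a d)
  have hpre : (fun z : ℂ => z + a) ⁻¹' Metric.ball a d = Metric.ball 0 d := by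
    ext z
    simp
  have h2 := hzero (p.comp (X + C a))
  simp only [eval_comp, eval_add, eval_X, eval_C, zero_add] at h2
  rw [← h, hpre, h2, ← hpre, hmp.measureReal_preimage
    Metric.isOpen_ball.measurableSet.nullMeasurableSet]

/-- The area mean value property applied to `p ^ 2`. -/
lemma norm_eval_sq_le_setIntegral_ball (p : ℂ[X]) (a : ℂ) (d : ℝ) :
    volume.real (Metric.ball a d) * ‖p.eval a‖ ^ 2 ≤ ∫ z in Metric.ball a d, ‖p.eval z‖ ^ 2 := by
  have h := norm_integral_le_integral_norm (μ := volume.restrict (Metric.ball a d))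
    (fun z => (p ^ 2).eval z)
  rw [setIntegral_ball_polynomial, norm_smul, Real.norm_of_nonneg measureReal_nonneg] at h
  simpa only [eval_pow, norm_pow] using h

/-- Dividing out one root inside `U` keeps the quotient bounded on `closure U`: on the frontier the
divisor `X - a` is bounded below, and the maximum principle carries the bound inside. -/
lemma exists_quotient_bound {U : Set ℂ} (hU : IsOpen U) (hb : Bornology.IsBounded U) {a : ℂ}
    (ha : a ∈ U) : ∃ A : ℝ, 0 ≤ A ∧ ∀ (p : ℂ[X]) (M : ℝ),
      (∀ z ∈ closure U, ‖p.eval z‖ ≤ M) → ∃ s : ℂ[X], p = (X - C a) * s + C (p.eval a) ∧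
        ∀ z ∈ closure U, ‖s.eval z‖ ≤ A * M := by
  obtain ⟨δ, hδ, hball⟩ := Metric.isOpen_iff.mp hU a ha
  refine ⟨2 / δ, by positivity, fun p M hM => ⟨p /ₘ (X - C a), ?_, ?_⟩⟩
  · conv_lhs => rw [← modByMonic_add_div p (X - C a), modByMonic_X_sub_C_eq_C_eval]
    ring
  · intro z hz
    refine Complex.norm_le_of_forall_mem_frontier_norm_le hb
      (Polynomial.differentiable _).diffContOnCl (fun w hw => ?_) hz
    have hwa : δ ≤ ‖w - a‖ := by
      by_contra! hlt
      rw [hU.frontier_eq] at hw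
      exact hw.2 (hball (by simpa [dist_eq_norm] using hlt))
    have heq : (w - a) * (p /ₘ (X - C a)).eval w = p.eval w - p.eval a := by
      conv_rhs => rw [← modByMonic_add_div p (X - C a), modByMonic_X_sub_C_eq_C_eval]
      simp
    have h1 : ‖w - a‖ * ‖(p /ₘ (X - C a)).eval w‖ ≤ 2 * M := by
      rw [← norm_mul, heq, two_mul]
      exact (norm_sub_le _ _).trans
        (add_le_add (hM w (frontier_subset_closure hw)) (hM a (subset_closure ha)))
    rw [div_mul_eq_mul_div, le_div_iff₀ hδ, mul_comm]
    exact (mul_le_mul_of_nonneg_right hwa (norm_nonneg _)).trans h1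

/-- Division by a monic polynomial with all its roots in `U`: a bound for `p` on `closure U` controls
the quotient there, and controls the remainder on any prescribed bounded set `S`, with a constant
independent of `p`. The remainder is built in Newton form along the roots. -/
lemma exists_division_bound {U : Set ℂ} (hU : IsOpen U) (hb : Bornology.IsBounded U)
    {S : Set ℂ} (hS : Bornology.IsBounded S) (m : Multiset ℂ) (hm : ∀ a ∈ m, a ∈ U) :
    ∃ A : ℝ, 0 ≤ A ∧ ∀ (p : ℂ[X]) (M : ℝ), 0 ≤ M →
      (∀ z ∈ closure U, ‖p.eval z‖ ≤ M) → ∃ s t : ℂ[X],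
        p = (m.map fun a => X - C a).prod * s + t ∧ t.degree < m.card ∧
        (∀ z ∈ closure U, ‖s.eval z‖ ≤ A * M) ∧ ∀ z ∈ S, ‖t.eval z‖ ≤ A * M := by
  induction m using Multiset.induction_on with
  | empty =>
    refine ⟨1, zero_le_one, fun p M hM hp => ⟨p, 0, by simp, by simp, by simpa using hp, ?_⟩⟩
    simpa using fun _ _ => hM
  | cons a m ih =>
    obtain ⟨A, hA, ih⟩ := ih fun b hb => hm b (Multiset.mem_cons_of_mem hb)
    have haU : a ∈ U := hm a (Multiset.mem_cons_self a m)
    obtain ⟨B, hB, hquot⟩ := exists_quotient_bound hU hb haU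
    obtain ⟨D, hD⟩ := hS.exists_norm_le
    -- `D` bounds `S`; the three summands control `s`, `(X - a) * t` and the constant `p(a)`.
    refine ⟨A * B + (|D| + ‖a‖) * (A * B) + 1, by positivity, fun p M hM hp => ?_⟩
    obtain ⟨p₁, hp₁, hbd⟩ := hquot p M hp
    obtain ⟨s, t, hst, hdeg, hs, ht⟩ := ih p₁ (B * M) (by positivity) hbd
    refine ⟨s, (X - C a) * t + C (p.eval a), ?_, ?_, fun z hz => ?_, fun z hz => ?_⟩
    · conv_lhs => rw [hp₁, hst]
      simp only [Multiset.map_cons, Multiset.prod_cons]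
      ring
    · rw [Multiset.card_cons]
      refine (degree_add_le _ _).trans_lt (max_lt ?_ ?_)
      · rw [degree_mul, degree_X_sub_C]
        rcases eq_or_ne t 0 with rfl | ht0
        · simp
        · rw [degree_eq_natDegree ht0] at hdeg ⊢
          norm_cast at hdeg ⊢
          omega
      · exact degree_C_le.trans_lt (by norm_cast; omega)
    · refine (hs z hz).trans ?_
      rw [← mul_assoc]
      refine mul_le_mul_of_nonneg_right ?_ hM
      have : 0 ≤ (|D| + ‖a‖) * (A * B) := by positivity
      linarith
    · have h1 : ‖z - a‖ ≤ |D| + ‖a‖ :=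
        (norm_sub_le _ _).trans (add_le_add_left ((hD z hz).trans (le_abs_self D)) _)
      have h2 : ‖(z - a) * t.eval z‖ ≤ (|D| + ‖a‖) * (A * (B * M)) := by
        rw [norm_mul]
        exact mul_le_mul h1 (ht z hz) (norm_nonneg _) (by positivity)
      have h3 : ‖p.eval a‖ ≤ M := hp a (subset_closure haU)
      have h4 : 0 ≤ A * B * M := by positivity
      simp only [eval_add, eval_mul, eval_sub, eval_X, eval_C]
      refine (norm_add_le _ _).trans ?_
      nlinarith

/-! ### Orthonormal sequences obtained from a linear map on polynomials -/

section Abstract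

variable {E : Type*} [NormedAddCommGroup E] [InnerProductSpace ℂ E]

lemma inner_map_eq_zero_of_degree_lt (T : ℂ[X] →ₗ[ℂ] E) {φ : ℕ → ℂ[X]}
    (hdeg : ∀ n, (φ n).natDegree = n) (hlc : ∀ n, (φ n).leadingCoeff ≠ 0)
    (hon : Orthonormal ℂ fun n => T (φ n)) (n : ℕ) (p : ℂ[X]) (hp : p.degree < n) :
    inner ℂ (T (φ n)) (T p) = 0 := by
  induction hk : p.natDegree using Nat.strong_induction_on generalizing p with
  | _ k ih =>
    rcases eq_or_ne p 0 with rfl | hp0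
    · simp
    have hkn : k < n := by
      rw [degree_eq_natDegree hp0, hk] at hp
      exact_mod_cast hp
    set c : ℂ := p.leadingCoeff / (φ k).leadingCoeff with hc
    have hc0 : c ≠ 0 := div_ne_zero (leadingCoeff_ne_zero.mpr hp0) (hlc k)
    have hφ0 : φ k ≠ 0 := leadingCoeff_ne_zero.mp (hlc k)
    have hlt : (p - c • φ k).degree < p.degree := by
      refine degree_sub_lt_left ?_ hp0 ?_
      · rw [degree_smul_of_smul_regular _ (IsSMulRegular.of_ne_zero hc0),
          degree_eq_natDegree hp0, degree_eq_natDegree hφ0, hk, hdeg]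
      · rw [leadingCoeff_smul_of_smul_regular _ (IsSMulRegular.of_ne_zero hc0), hc, smul_eq_mul,
          div_mul_cancel₀ _ (hlc k)]
    have hzero : inner ℂ (T (φ n)) (T (p - c • φ k)) = 0 := by
      rcases eq_or_ne (p - c • φ k) 0 with h0 | h0
      · simp [h0]
      · exact ih _ ((natDegree_lt_natDegree h0 hlt).trans_eq hk) _ (hlt.trans hp) rfl
    have horth : inner ℂ (T (φ n)) (T (φ k)) = 0 := hon.2 hkn.ne'
    rw [map_sub, map_smul, inner_sub_right, inner_smul_right, horth, mul_zero, sub_zero] at hzero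
    exact hzero

/-- The extremal property of orthonormal polynomials: the left-hand side is the modulus of the
coefficient of `φ n` in the orthonormal expansion of `p`. -/
lemma norm_coeff_div_leadingCoeff_le (T : ℂ[X] →ₗ[ℂ] E) {φ : ℕ → ℂ[X]}
    (hdeg : ∀ n, (φ n).natDegree = n) (hlc : ∀ n, (φ n).leadingCoeff ≠ 0)
    (hon : Orthonormal ℂ fun n => T (φ n)) (n : ℕ) (p : ℂ[X]) (hp : p.natDegree ≤ n) :
    ‖p.coeff n / (φ n).leadingCoeff‖ ≤ ‖T p‖ := by
  set c : ℂ := p.coeff n / (φ n).leadingCoeff with hc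
  have hlow : (p - c • φ n).degree < n := by
    refine (degree_lt_iff_coeff_zero _ _).mpr fun k hk => ?_
    rw [coeff_sub, coeff_smul, smul_eq_mul]
    rcases hk.eq_or_lt with rfl | hk
    · have : (φ n).coeff n = (φ n).leadingCoeff := by rw [leadingCoeff, hdeg]
      rw [this, hc, div_mul_cancel₀ _ (hlc n), sub_self]
    · rw [coeff_eq_zero_of_natDegree_lt (hp.trans_lt hk),
        coeff_eq_zero_of_natDegree_lt (by rwa [hdeg]), mul_zero, sub_zero]
  have h := inner_map_eq_zero_of_degree_lt T hdeg hlc hon n _ hlow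
  rw [map_sub, map_smul, inner_sub_right, inner_smul_right, inner_self_eq_norm_sq_to_K, hon.1 n,
    sub_eq_zero] at h
  have hle := norm_inner_le_norm (𝕜 := ℂ) (T (φ n)) (T p)
  rw [h, hon.1 n] at hle
  simpa using hle

/-- Bessel's inequality for a bounded functional `ℓ`. No completeness is assumed, so instead of a
Riesz representative the bound is tested on `∑ conj (ℓ (φ i)) • φ i`. -/
lemma sum_norm_sq_le_of_bounded (T : ℂ[X] →ₗ[ℂ] E) (ℓ : ℂ[X] →ₗ[ℂ] ℂ) {C : ℝ}
    (hℓ : ∀ p, ‖ℓ p‖ ^ 2 ≤ C * ‖T p‖ ^ 2) {φ : ℕ → ℂ[X]}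
    (hon : Orthonormal ℂ fun n => T (φ n)) (s : Finset ℕ) :
    ∑ i ∈ s, ‖ℓ (φ i)‖ ^ 2 ≤ C := by
  set S : ℝ := ∑ i ∈ s, ‖ℓ (φ i)‖ ^ 2 with hS
  have hS0 : 0 ≤ S := Finset.sum_nonneg fun i _ => by positivity
  set p : ℂ[X] := ∑ i ∈ s, (starRingEnd ℂ) (ℓ (φ i)) • φ i with hp
  have hℓp : ℓ p = (S : ℂ) := by
    rw [hp, hS, map_sum, Complex.ofReal_sum]
    refine Finset.sum_congr rfl fun i _ => ?_
    rw [map_smul, smul_eq_mul, Complex.conj_mul']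
    push_cast
    rfl
  have hTp : ‖T p‖ ^ 2 = S := by
    have h := hon.inner_sum (fun i => (starRingEnd ℂ) (ℓ (φ i)))
      (fun i => (starRingEnd ℂ) (ℓ (φ i))) s
    have hTp' : T p = ∑ i ∈ s, (starRingEnd ℂ) (ℓ (φ i)) • T (φ i) := by
      rw [hp, map_sum]
      simp only [map_smul]
    rw [← hTp', inner_self_eq_norm_sq_to_K] at h
    have h2 : ((‖T p‖ ^ 2 : ℝ) : ℂ) = (S : ℂ) := by
      rw [← hℓp, Complex.ofReal_pow]
      refine h.trans ?_
      rw [hp, map_sum]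
      refine Finset.sum_congr rfl fun i _ => ?_
      rw [map_smul, smul_eq_mul, Complex.conj_conj, mul_comm]
    exact_mod_cast h2
  have h := hℓ p
  rw [hℓp, hTp, Complex.norm_real, Real.norm_of_nonneg hS0, sq] at h
  rcases hS0.eq_or_lt with h0 | h0
  · have := hℓ (φ 0)
    rw [hon.1 0] at this
    nlinarith [sq_nonneg ‖ℓ (φ 0)‖]
  · exact le_of_mul_le_mul_right h h0

/-- Gram-Schmidt on the images of the monomials; each vector produced is the image of a positive
multiple of a monic polynomial. -/
lemma exists_orthonormal_polynomials (T : ℂ[X] →ₗ[ℂ] E) (hT : Function.Injective T) :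
    ∃ φ : ℕ → ℂ[X], (∀ n, (φ n).natDegree = n) ∧ (∀ n, (φ n).leadingCoeff.im = 0) ∧
      (∀ n, 0 < (φ n).leadingCoeff.re) ∧ Orthonormal ℂ fun n => T (φ n) := by
  set f : ℕ → E := fun n => T (X ^ n) with hf
  have hli : LinearIndependent ℂ f := by
    have h := (basisMonomials ℂ).linearIndependent.map' T (LinearMap.ker_eq_bot.mpr hT)
    have hfe : f = T ∘ basisMonomials ℂ := by
      ext n
      simp [hf, X_pow_eq_monomial]
    rw [hfe]
    exact h
  set g : ℕ → E := InnerProductSpace.gramSchmidt ℂ f with hg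
  have hspan : ∀ n, Submodule.span ℂ (f '' Set.Iio n) = (degreeLT ℂ n).map T := by
    intro n
    rw [degreeLT_eq_span_X_pow, Submodule.map_span]
    congr 1
    ext v
    simp [hf]
  have hlow : ∀ n, ∃ t ∈ degreeLT ℂ n, T t = f n - g n := by
    intro n
    rw [← Submodule.mem_map, ← hspan, ← InnerProductSpace.span_gramSchmidt_Iio]
    have h := InnerProductSpace.gramSchmidt_def'' ℂ f n
    rw [sub_eq_of_eq_add' h]
    exact Submodule.sum_mem _ fun i hi => Submodule.smul_mem _ _
      (Submodule.subset_span ⟨i, by simpa using hi, rfl⟩)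
  choose t ht hTt using hlow
  have hgn : ∀ n, 0 < ‖g n‖ := fun n =>
    norm_pos_iff.mpr (InnerProductSpace.gramSchmidt_ne_zero n hli)
  have hmonic : ∀ n, (X ^ n - t n).Monic := fun n =>
    monic_X_pow_sub (mem_degreeLT.mp (ht n))
  have hdeg : ∀ n, (X ^ n - t n).natDegree = n := fun n => by
    rw [natDegree_eq_of_degree_eq_some]
    rw [degree_sub_eq_left_of_degree_lt, degree_X_pow]
    rw [degree_X_pow]
    exact mem_degreeLT.mp (ht n)
  have hc : ∀ n, ((‖g n‖⁻¹ : ℝ) : ℂ) ≠ 0 := fun n => by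
    exact_mod_cast (inv_pos.mpr (hgn n)).ne'
  have hlc : ∀ n, (((‖g n‖⁻¹ : ℝ) : ℂ) • (X ^ n - t n)).leadingCoeff = ((‖g n‖⁻¹ : ℝ) : ℂ) := by
    intro n
    rw [leadingCoeff_smul_of_smul_regular _ (IsSMulRegular.of_ne_zero (hc n)), hmonic n,
      smul_eq_mul, mul_one]
  refine ⟨fun n => ((‖g n‖⁻¹ : ℝ) : ℂ) • (X ^ n - t n), fun n => ?_, fun n => ?_, fun n => ?_, ?_⟩
  · rw [natDegree_smul _ (hc n), hdeg]
  · rw [hlc, Complex.ofReal_im]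
  · rw [hlc, Complex.ofReal_re]
    exact inv_pos.mpr (hgn n)
  · convert InnerProductSpace.gramSchmidtNormed_orthonormal hli using 2 with n
    rw [map_smul, map_sub, hTt, sub_sub_cancel, InnerProductSpace.gramSchmidtNormed]
    simp [hg]

end Abstract

/-! ### The area norm on a compact set -/

lemma Continuous.memLp_two_restrict_of_isCompact {f : ℂ → ℂ} (hf : Continuous f) {K : Set ℂ}
    (hK : IsCompact K) : MemLp f 2 (volume.restrict K) :=
  (memLp_two_iff_integrable_sq_norm hf.aestronglyMeasurable).mpr
    ((hf.norm.pow 2).continuousOn.integrableOn_compact hK)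

/-- The map sending a polynomial to the class of its evaluation function in `L²` of area measure on
the compact set `K`. -/
noncomputable def polynomialToL2 {K : Set ℂ} (hK : IsCompact K) :
    ℂ[X] →ₗ[ℂ] Lp ℂ 2 (volume.restrict K) where
  toFun p := MemLp.toLp (fun z => p.eval z) (p.continuous.memLp_two_restrict_of_isCompact hK)
  map_add' p s := by
    rw [← MemLp.toLp_add]
    congr 1
    ext z
    simp
  map_smul' c p := by
    rw [RingHom.id_apply, ← MemLp.toLp_const_smul]
    congr 1
    ext z
    simp

lemma inner_polynomialToL2 {K : Set ℂ} (hK : IsCompact K) (p s : ℂ[X]) :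
    inner ℂ (polynomialToL2 hK p) (polynomialToL2 hK s)
      = ∫ z in K, s.eval z * (starRingEnd ℂ) (p.eval z) := by
  rw [L2.inner_def]
  refine integral_congr_ae ?_
  filter_upwards [MemLp.coeFn_toLp (p.continuous.memLp_two_restrict_of_isCompact hK),
    MemLp.coeFn_toLp (s.continuous.memLp_two_restrict_of_isCompact hK)] with z hp hs
  have hp' : (polynomialToL2 hK p) z = p.eval z := hp
  have hs' : (polynomialToL2 hK s) z = s.eval z := hs
  rw [hp', hs', RCLike.inner_apply]

lemma norm_polynomialToL2_sq {K : Set ℂ} (hK : IsCompact K) (p : ℂ[X]) :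
    ‖polynomialToL2 hK p‖ ^ 2 = ∫ z in K, ‖p.eval z‖ ^ 2 := by
  have h := inner_polynomialToL2 hK p p
  rw [inner_self_eq_norm_sq_to_K] at h
  simp only [Complex.mul_conj'] at h
  have h2 : ∫ z in K, ((‖p.eval z‖ : ℂ) ^ 2) = ((∫ z in K, ‖p.eval z‖ ^ 2 : ℝ) : ℂ) := by
    rw [← integral_complex_ofReal]
    simp
  rw [h2] at h
  exact Complex.ofReal_injective ((Complex.ofReal_pow _ 2).trans h)

lemma integrableOn_norm_eval_sq {K : Set ℂ} (hK : IsCompact K) (p : ℂ[X]) :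
    IntegrableOn (fun z => ‖p.eval z‖ ^ 2) K :=
  (p.continuous.norm.pow 2).continuousOn.integrableOn_compact hK

/-- Point evaluation at `a` is bounded in the area norm of `K` as soon as a disc around `a` lies in
`K`. -/
lemma norm_eval_sq_le_setIntegral {K : Set ℂ} (hK : IsCompact K) (p : ℂ[X]) {a : ℂ} {d : ℝ}
    (hd : 0 < d) (hsub : Metric.ball a d ⊆ K) :
    ‖p.eval a‖ ^ 2 ≤ (Real.pi * d ^ 2)⁻¹ * ∫ z in K, ‖p.eval z‖ ^ 2 := by
  have hvol : volume.real (Metric.ball a d) = Real.pi * d ^ 2 := by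
    rw [Measure.real, Complex.volume_ball]
    simp [hd.le, mul_comm]
  have h := norm_eval_sq_le_setIntegral_ball p a d
  rw [hvol] at h
  rw [inv_mul_eq_div, le_div_iff₀' (by positivity)]
  exact h.trans (setIntegral_mono_set (integrableOn_norm_eval_sq hK p)
    (Eventually.of_forall fun z => by positivity) hsub.eventuallyLE)

lemma polynomialToL2_injective {K : Set ℂ} (hK : IsCompact K) (hne : (interior K).Nonempty) :
    Function.Injective (polynomialToL2 hK) := by
  refine (injective_iff_map_eq_zero _).mpr fun p hp => ?_
  refine eq_zero_of_infinite_isRoot p ?_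
  have hinf : (interior K).Infinite := infinite_of_mem_nhds hne.some
    (isOpen_interior.mem_nhds hne.some_mem)
  refine hinf.mono fun z hz => ?_
  obtain ⟨d, hd, hsub⟩ := Metric.isOpen_iff.mp isOpen_interior z hz
  have h := norm_eval_sq_le_setIntegral hK p hd (hsub.trans interior_subset)
  rw [← norm_polynomialToL2_sq hK, hp, norm_zero] at h
  have h0 : ‖p.eval z‖ = 0 := by
    refine pow_eq_zero_iff two_ne_zero |>.mp (le_antisymm ?_ (by positivity))
    simpa using h
  exact norm_eq_zero.mp h0

lemma tendsto_eval_zero_of_orthonormal {K : Set ℂ} (hK : IsCompact K) {φ : ℕ → ℂ[X]}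
    (hon : Orthonormal ℂ fun n => polynomialToL2 hK (φ n)) {z : ℂ} (hz : z ∈ interior K) :
    Tendsto (fun n => ‖(φ n).eval z‖ ^ 2) atTop (𝓝 0) := by
  obtain ⟨d, hd, hsub⟩ := Metric.isOpen_iff.mp isOpen_interior z hz
  refine (summable_of_sum_le (c := (Real.pi * d ^ 2)⁻¹) (fun n => by positivity)
    fun s => ?_).tendsto_atTop_zero
  refine sum_norm_sq_le_of_bounded (polynomialToL2 hK) (leval z) (fun p => ?_) hon s
  rw [norm_polynomialToL2_sq]
  exact norm_eval_sq_le_setIntegral hK p hd (hsub.trans interior_subset)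

/-- Orthonormal polynomials for area measure tend to `0` uniformly on compact subsets of the interior.
Pointwise convergence is upgraded through the mean value property: the integrals of `‖φ n‖ ^ 2` over
a slightly larger compact set tend to `0` by dominated convergence. -/
lemma eventually_forall_norm_eval_le {K : Set ℂ} (hK : IsCompact K) {φ : ℕ → ℂ[X]}
    (hon : Orthonormal ℂ fun n => polynomialToL2 hK (φ n)) {L : Set ℂ} (hL : IsCompact L)
    (hLK : L ⊆ interior K) {ε : ℝ} (hε : 0 < ε) :
    ∀ᶠ n in atTop, ∀ z ∈ L, ‖(φ n).eval z‖ ≤ ε := by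
  obtain ⟨d, hd, hdK⟩ := hL.exists_cthickening_subset_open isOpen_interior hLK
  set L' := Metric.cthickening d L with hL'
  have hL'c : IsCompact L' := hL.cthickening
  obtain ⟨e, he, heK⟩ := hL'c.exists_cthickening_subset_open isOpen_interior hdK
  have hbound : ∀ n, ∀ z ∈ L', ‖(φ n).eval z‖ ^ 2 ≤ (Real.pi * e ^ 2)⁻¹ := by
    intro n z hz
    have hball : Metric.ball z e ⊆ K := (Metric.ball_subset_thickening hz e).trans
      ((Metric.thickening_subset_cthickening e L').trans (heK.trans interior_subset))
    have h := norm_eval_sq_le_setIntegral hK (φ n) he hball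
    rwa [← norm_polynomialToL2_sq hK, hon.1 n, one_pow, mul_one] at h
  have hint : Tendsto (fun n => ∫ z in L', ‖(φ n).eval z‖ ^ 2) atTop (𝓝 0) := by
    have h := tendsto_integral_of_dominated_convergence (μ := volume.restrict L')
      (F := fun n z => ‖(φ n).eval z‖ ^ 2) (f := fun _ => 0) (fun _ => (Real.pi * e ^ 2)⁻¹)
      (fun n => ((φ n).continuous.norm.pow 2).aestronglyMeasurable)
      (continuousOn_const.integrableOn_compact hL'c)
      (fun n => (ae_restrict_iff' hL'c.measurableSet).mpr (Eventually.of_forall fun z hz => by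
        rw [Real.norm_of_nonneg (by positivity)]
        exact hbound n z hz))
      ((ae_restrict_iff' hL'c.measurableSet).mpr (Eventually.of_forall fun z hz =>
        tendsto_eval_zero_of_orthonormal hK hon (hdK hz)))
    simpa using h
  have hsmall := hint.const_mul (Real.pi * d ^ 2)⁻¹
  rw [mul_zero] at hsmall
  filter_upwards [hsmall.eventually (gt_mem_nhds (pow_pos hε 2))] with n hn z hz
  have hball : Metric.ball z d ⊆ L' :=
    (Metric.ball_subset_thickening hz d).trans (Metric.thickening_subset_cthickening d L)
  have h := (norm_eval_sq_le_setIntegral hL'c (φ n) hd hball).trans hn.le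
  exact le_of_sq_le_sq h hε.le

/-! ### Lemniscates -/

lemma isCompact_filledLemniscate {P : ℂ[X]} (hP : 0 < P.degree) (r : ℝ) :
    IsCompact {z : ℂ | ‖P.eval z‖ ≤ r} := by
  have h := P.tendsto_norm_atTop hP (tendsto_norm_cocompact_atTop (E := ℂ))
  obtain ⟨t, ht, hsub⟩ := mem_cocompact.mp (h.eventually_gt_atTop r)
  refine ht.of_isClosed_subset (isClosed_le P.continuous.norm continuous_const) fun z hz => ?_
  by_contra hzt
  have hlt : r < ‖P.eval z‖ := hsub hzt
  exact absurd hlt (not_lt.mpr hz)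

lemma lemniscate_subset_interior (P : ℂ[X]) {ρ r : ℝ} (hρ : ρ < r) :
    {z : ℂ | ‖P.eval z‖ ≤ ρ} ⊆ interior {z : ℂ | ‖P.eval z‖ ≤ r} := by
  intro z hz
  have hopen : IsOpen {w : ℂ | ‖P.eval w‖ < r} := isOpen_lt P.continuous.norm continuous_const
  have hsub : {w : ℂ | ‖P.eval w‖ < r} ⊆ {w : ℂ | ‖P.eval w‖ ≤ r} :=
    Set.ofPred_subset_ofPred.mpr fun _ hw => hw.le
  exact interior_maximal hsub hopen (lt_of_le_of_lt hz hρ : ‖P.eval z‖ < r)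

/-- The quotient of `p` by `P` is at most `‖p‖ / ρ` on `{‖P‖ ≤ r}`, up to a multiple of the maximum
of `‖p‖` on `{‖P‖ ≤ ρ}`. -/
lemma exists_division_monic_bound {P : ℂ[X]} (hP : P.Monic) (hdeg : 0 < P.degree) {ρ : ℝ}
    (hρ : 0 < ρ) (r : ℝ) : ∃ A : ℝ, 0 ≤ A ∧ ∀ (p : ℂ[X]) (M : ℝ), 0 ≤ M →
      (∀ z, ‖P.eval z‖ ≤ ρ → ‖p.eval z‖ ≤ M) → ∃ s t : ℂ[X],
        p = P * s + t ∧ t.degree < P.degree ∧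
        ∀ z, ‖P.eval z‖ ≤ r → ‖s.eval z‖ ≤ ‖p.eval z‖ / ρ + A * M := by
  have hsplit : P.Splits := IsAlgClosed.splits P
  have hprod : P = (P.roots.map fun a => X - C a).prod := hsplit.eq_prod_roots_of_monic hP
  have hU : IsOpen {z : ℂ | ‖P.eval z‖ < ρ} := isOpen_lt P.continuous.norm continuous_const
  have hUb : Bornology.IsBounded {z : ℂ | ‖P.eval z‖ < ρ} :=
    (isCompact_filledLemniscate hdeg ρ).isBounded.subset
      (Set.ofPred_subset_ofPred.mpr fun _ hz => hz.le)
  have hcl : closure {z : ℂ | ‖P.eval z‖ < ρ} ⊆ {z : ℂ | ‖P.eval z‖ ≤ ρ} :=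
    closure_lt_subset_le P.continuous.norm continuous_const
  have hroots : ∀ a ∈ P.roots, a ∈ {z : ℂ | ‖P.eval z‖ < ρ} := fun a ha => by
    rw [Set.mem_ofPred_eq, (isRoot_of_mem_roots ha).eq_zero, norm_zero]
    exact hρ
  obtain ⟨A, hA, h⟩ := exists_division_bound hU hUb (isCompact_filledLemniscate hdeg r).isBounded
    P.roots hroots
  refine ⟨A + A / ρ, by positivity, fun p M hM hp => ?_⟩
  obtain ⟨s, t, hst, ht, hs, htS⟩ := h p M hM fun z hz => hp z (hcl hz)
  rw [← hprod] at hst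
  refine ⟨s, t, hst, ?_, fun z hz => ?_⟩
  · rwa [degree_eq_natDegree hP.ne_zero, hsplit.natDegree_eq_card_roots]
  · have hAM : 0 ≤ A * M := by positivity
    have hquot : 0 ≤ A / ρ * M := by positivity
    have hp0 : 0 ≤ ‖p.eval z‖ / ρ := by positivity
    rcases lt_or_ge ‖P.eval z‖ ρ with hlt | hge
    · have := hs z (subset_closure hlt)
      linarith
    · have heq : P.eval z * s.eval z = p.eval z - t.eval z := by
        conv_rhs => rw [hst]
        simp
      have h1 : ρ * ‖s.eval z‖ ≤ ‖p.eval z‖ + A * M :=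
        calc ρ * ‖s.eval z‖ ≤ ‖P.eval z‖ * ‖s.eval z‖ :=
              mul_le_mul_of_nonneg_right hge (norm_nonneg _)
          _ = ‖p.eval z - t.eval z‖ := by rw [← norm_mul, heq]
          _ ≤ ‖p.eval z‖ + A * M := (norm_sub_le _ _).trans (by linarith [htS z hz])
      have h2 : ‖s.eval z‖ ≤ (‖p.eval z‖ + A * M) / ρ := by
        rw [le_div_iff₀ hρ]
        linarith
      have h3 : (‖p.eval z‖ + A * M) / ρ = ‖p.eval z‖ / ρ + A / ρ * M := by ring
      linarith

/-- The pointwise bound is squared with `2 x c ≤ c x² + c`. -/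
lemma norm_polynomialToL2_sq_le_of_pointwise {K : Set ℂ} (hK : IsCompact K) {p s : ℂ[X]}
    {ρ c : ℝ} (hc : 0 ≤ c) (h : ∀ z ∈ K, ‖s.eval z‖ ≤ ‖p.eval z‖ / ρ + c) :
    ‖polynomialToL2 hK s‖ ^ 2
      ≤ (1 + c) / ρ ^ 2 * ‖polynomialToL2 hK p‖ ^ 2 + (c ^ 2 + c) * volume.real K := by
  have hconst : IntegrableOn (fun _ : ℂ => c ^ 2 + c) K :=
    continuousOn_const.integrableOn_compact hK
  have hmul := (integrableOn_norm_eval_sq hK p).const_mul ((1 + c) / ρ ^ 2)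
  calc ‖polynomialToL2 hK s‖ ^ 2 = ∫ z in K, ‖s.eval z‖ ^ 2 := norm_polynomialToL2_sq hK s
    _ ≤ ∫ z in K, ((1 + c) / ρ ^ 2 * ‖p.eval z‖ ^ 2 + (c ^ 2 + c)) := by
      refine setIntegral_mono_on (integrableOn_norm_eval_sq hK s) (hmul.add hconst)
        hK.measurableSet fun z hz => ?_
      refine (pow_le_pow_left₀ (norm_nonneg _) (h z hz) 2).trans ?_
      have : (1 + c) / ρ ^ 2 * ‖p.eval z‖ ^ 2 = (1 + c) * (‖p.eval z‖ / ρ) ^ 2 := by ring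
      rw [this]
      nlinarith [mul_nonneg hc (sq_nonneg (‖p.eval z‖ / ρ - 1))]
    _ = _ := by
      rw [integral_add hmul hconst, integral_const_mul, norm_polynomialToL2_sq, setIntegral_const,
        smul_eq_mul, mul_comm (volume.real K)]

lemma IsOrthonormalPolynomials.orthonormal_polynomialToL2 {K : Set ℂ} (hK : IsCompact K)
    {φ : ℕ → ℂ[X]} (hφ : IsOrthonormalPolynomials (volume.restrict K) φ) :
    Orthonormal ℂ fun n => polynomialToL2 hK (φ n) := by
  classical
  refine orthonormal_iff_ite.mpr fun i j => ?_
  rw [inner_polynomialToL2, hφ.orthonormal j i]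

lemma exists_isOrthonormalPolynomials {K : Set ℂ} (hK : IsCompact K)
    (hne : (interior K).Nonempty) :
    ∃ φ : ℕ → ℂ[X], IsOrthonormalPolynomials (volume.restrict K) φ := by
  classical
  obtain ⟨φ, hdeg, him, hpos, hon⟩ :=
    exists_orthonormal_polynomials (polynomialToL2 hK) (polynomialToL2_injective hK hne)
  refine ⟨φ, hdeg, him, hpos, fun n m => ?_⟩
  rw [← inner_polynomialToL2 hK]
  exact orthonormal_iff_ite.mp hon m n

lemma IsOrthonormalPolynomials.leadingKappa_pos {μ : Measure ℂ} {φ : ℕ → ℂ[X]}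
    (hφ : IsOrthonormalPolynomials μ φ) (n : ℕ) : 0 < leadingKappa φ n :=
  hφ.leadingCoeff_pos n

lemma IsOrthonormalPolynomials.leadingCoeff_eq {μ : Measure ℂ} {φ : ℕ → ℂ[X]}
    (hφ : IsOrthonormalPolynomials μ φ) (n : ℕ) :
    (φ n).leadingCoeff = (leadingKappa φ n : ℂ) :=
  Complex.ext rfl (hφ.leadingCoeff_im n)

/-- The extremal property, for a polynomial sharing its leading coefficient with `φ k`. -/
lemma IsOrthonormalPolynomials.div_leadingKappa_le {K : Set ℂ} (hK : IsCompact K)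
    {φ : ℕ → ℂ[X]} (hφ : IsOrthonormalPolynomials (volume.restrict K) φ) {n k : ℕ} {p : ℂ[X]}
    (hdeg : p.natDegree = n) (hlc : p.leadingCoeff = (φ k).leadingCoeff) :
    leadingKappa φ k / leadingKappa φ n ≤ ‖polynomialToL2 hK p‖ := by
  have hne : ∀ n, (φ n).leadingCoeff ≠ 0 := fun n => by
    rw [hφ.leadingCoeff_eq]
    exact_mod_cast (hφ.leadingKappa_pos n).ne'
  have h := norm_coeff_div_leadingCoeff_le (polynomialToL2 hK) hφ.natDegree_eq hne
    (hφ.orthonormal_polynomialToL2 hK) n p hdeg.le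
  have hcoeff : p.coeff n = (φ k).leadingCoeff := by rw [← hlc, leadingCoeff, hdeg]
  rw [hcoeff, hφ.leadingCoeff_eq, hφ.leadingCoeff_eq, ← Complex.ofReal_div, Complex.norm_real] at h
  exact (Real.le_norm_self _).trans h

lemma leadingKappa_div_le {P : ℂ[X]} (hP : P.Monic) (hdeg : 0 < P.degree) {r : ℝ} (hr : 0 < r)
    {φ : ℕ → ℂ[X]} (hφ : IsOrthonormalPolynomials (lemniscateArea P r) φ) (n : ℕ) :
    leadingKappa φ n / leadingKappa φ (n + P.natDegree) ≤ r := by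
  have hK := isCompact_filledLemniscate hdeg r
  have hφ0 : φ n ≠ 0 := fun h => by simpa [h] using hφ.leadingCoeff_pos n
  refine (hφ.div_leadingKappa_le hK (p := P * φ n) ?_ ?_).trans ?_
  · rw [hP.natDegree_mul' hφ0, hφ.natDegree_eq, add_comm]
  · rw [leadingCoeff_monic_mul hP]
  · refine le_of_sq_le_sq ?_ hr.le
    have h1 := (hφ.orthonormal_polynomialToL2 hK).1 n
    calc ‖polynomialToL2 hK (P * φ n)‖ ^ 2
        = ∫ z in {z : ℂ | ‖P.eval z‖ ≤ r}, ‖(P * φ n).eval z‖ ^ 2 := norm_polynomialToL2_sq hK _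
      _ ≤ ∫ z in {z : ℂ | ‖P.eval z‖ ≤ r}, r ^ 2 * ‖(φ n).eval z‖ ^ 2 := by
        refine setIntegral_mono_on (integrableOn_norm_eval_sq hK _)
          ((integrableOn_norm_eval_sq hK _).const_mul _) hK.measurableSet fun z hz => ?_
        rw [eval_mul, norm_mul, mul_pow]
        have : ‖P.eval z‖ ^ 2 ≤ r ^ 2 := pow_le_pow_left₀ (norm_nonneg _) hz 2
        gcongr
      _ = r ^ 2 := by
        rw [integral_const_mul, ← norm_polynomialToL2_sq hK, h1, one_pow, mul_one]

/-- The quotient of `φ (n + q)` by `P` is a competitor of degree `n` in the extremal property. -/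
lemma eventually_div_leadingKappa_sq_le {P : ℂ[X]} (hP : P.Monic) (hdeg : 0 < P.degree)
    {ρ r : ℝ} (hρ : 0 < ρ) (hρr : ρ < r) {φ : ℕ → ℂ[X]}
    (hφ : IsOrthonormalPolynomials (lemniscateArea P r) φ) {c : ℝ} (hc : 0 < c) :
    ∀ᶠ n in atTop, (leadingKappa φ (n + P.natDegree) / leadingKappa φ n) ^ 2
      ≤ (1 + c) / ρ ^ 2 + (c ^ 2 + c) * volume.real {z : ℂ | ‖P.eval z‖ ≤ r} := by
  have hK := isCompact_filledLemniscate hdeg r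
  have hon := hφ.orthonormal_polynomialToL2 hK
  obtain ⟨A, hA, hdiv⟩ := exists_division_monic_bound hP hdeg hρ r
  have hε : 0 < c / (A + 1) := by positivity
  have hsmall := eventually_forall_norm_eval_le hK hon (isCompact_filledLemniscate hdeg ρ)
    (lemniscate_subset_interior P hρr) hε
  filter_upwards [(tendsto_add_atTop_nat P.natDegree).eventually hsmall] with n hn
  obtain ⟨s, t, hst, ht, hs⟩ := hdiv (φ (n + P.natDegree)) (c / (A + 1)) hε.le hn
  have hs' : ∀ z ∈ {z : ℂ | ‖P.eval z‖ ≤ r},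
      ‖s.eval z‖ ≤ ‖(φ (n + P.natDegree)).eval z‖ / ρ + c := fun z hz => by
    have : A * (c / (A + 1)) ≤ c := by
      rw [mul_div_assoc', div_le_iff₀ (by positivity)]
      nlinarith
    linarith [hs z hz]
  have hφdeg : (φ (n + P.natDegree)).degree = ((n + P.natDegree : ℕ) : WithBot ℕ) := by
    rw [degree_eq_natDegree, hφ.natDegree_eq]
    exact fun h => by simpa [h] using hφ.leadingCoeff_pos (n + P.natDegree)
  have htlt : t.degree < (φ (n + P.natDegree)).degree := by
    rw [hφdeg]
    refine ht.trans_le ?_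
    rw [degree_eq_natDegree hP.ne_zero]
    exact_mod_cast Nat.le_add_left _ _
  have hPs : P * s = φ (n + P.natDegree) - t := by rw [hst]; ring
  have hlc : s.leadingCoeff = (φ (n + P.natDegree)).leadingCoeff := by
    rw [← leadingCoeff_monic_mul hP (q := s), hPs, leadingCoeff_sub_of_degree_lt htlt]
  have hs0 : s ≠ 0 := fun h => by
    have := hφ.leadingCoeff_pos (n + P.natDegree)
    rw [← hlc, h] at this
    simp at this
  have hsdeg : s.natDegree = n := by
    have h1 : (P * s).natDegree = n + P.natDegree := by
      rw [hPs]
      refine natDegree_eq_of_degree_eq_some ?_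
      rw [degree_sub_eq_left_of_degree_lt htlt, hφdeg]
    rw [hP.natDegree_mul' hs0] at h1
    omega
  have h1 := hφ.div_leadingKappa_le hK hsdeg hlc
  have h2 := norm_polynomialToL2_sq_le_of_pointwise hK hc.le hs'
  rw [hon.1, one_pow, mul_one] at h2
  exact (pow_le_pow_left₀ (div_pos (hφ.leadingKappa_pos _) (hφ.leadingKappa_pos _)).le h1 2).trans h2

theorem corollary1p7 (P : Polynomial ℂ) (q : ℕ) (r : ℝ) (hP : P.Monic)
    (hdeg : P.natDegree = q) (hq : 1 ≤ q) (hr : 0 < r) :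
    (∃ φ : ℕ → Polynomial ℂ, IsOrthonormalPolynomials (lemniscateArea P r) φ) ∧
      ∀ φ : ℕ → Polynomial ℂ, IsOrthonormalPolynomials (lemniscateArea P r) φ →
        Tendsto (fun n : ℕ => leadingKappa φ n / leadingKappa φ (n + q)) atTop (𝓝 r) := by
  subst hdeg
  have hdeg : 0 < P.degree := natDegree_pos_iff_degree_pos.mp hq
  refine ⟨?_, fun φ hφ => ?_⟩
  · obtain ⟨a, ha⟩ := IsAlgClosed.exists_root P hdeg.ne'
    refine exists_isOrthonormalPolynomials (isCompact_filledLemniscate hdeg r)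
      ⟨a, lemniscate_subset_interior P hr ?_⟩
    rw [Set.mem_ofPred_eq, ha.eq_zero, norm_zero]
  · refine tendsto_order.mpr ⟨fun b hb => ?_, fun b hb =>
      Eventually.of_forall fun n => (leadingKappa_div_le hP hdeg hr hφ n).trans_lt hb⟩
    -- `b'` and `ρ` are positive with `b < b' < ρ < r`, leaving room to choose `c` below.
    obtain ⟨b', hb', hb'r⟩ := exists_between (max_lt hb hr)
    obtain ⟨ρ, hbρ, hρr⟩ := exists_between hb'r
    have hb'0 : 0 < b' := (le_max_right _ _).trans_lt hb'
    have hρ0 : 0 < ρ := hb'0.trans hbρ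
    set V := volume.real {z : ℂ | ‖P.eval z‖ ≤ r} with hV
    have hlim : Tendsto (fun c : ℝ => (1 + c) / ρ ^ 2 + (c ^ 2 + c) * V) (𝓝[>] 0)
        (𝓝 (1 / ρ ^ 2)) := by
      have hcont : Continuous fun c : ℝ => (1 + c) / ρ ^ 2 + (c ^ 2 + c) * V := by fun_prop
      have h := hcont.tendsto 0
      norm_num at h
      rw [one_div]
      exact h.mono_left nhdsWithin_le_nhds
    have hlt : 1 / ρ ^ 2 < 1 / b' ^ 2 :=
      one_div_lt_one_div_of_lt (by positivity) (pow_lt_pow_left₀ hbρ hb'0.le two_ne_zero)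
    obtain ⟨c, hcV, hc⟩ := ((hlim.eventually (gt_mem_nhds hlt)).and self_mem_nhdsWithin).exists
    filter_upwards [eventually_div_leadingKappa_sq_le hP hdeg hρ0 hρr hφ hc] with n hn
    have hκ := hφ.leadingKappa_pos n
    have hκ' := hφ.leadingKappa_pos (n + P.natDegree)
    have h1 : (leadingKappa φ (n + P.natDegree) / leadingKappa φ n) ^ 2 < (1 / b') ^ 2 := by
      rw [one_div_pow]
      exact hn.trans_lt hcV
    have h2 := lt_of_pow_lt_pow_left₀ 2 (by positivity) h1
    rw [div_lt_div_iff₀ hκ hb'0, one_mul] at h2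
    refine ((le_max_left _ _).trans_lt hb').trans ?_
    rw [lt_div_iff₀ hκ']
    linarith
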